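/- There is an absolute constant $c>0$ such that the following holds. Fix $\gamma>0$, integers $0\le k\le d$ and $N\ge 1$, a probability distribution $\mathcal D$ on $\mathbb R^d\times\{-1,1\}$, and a vector $h\in\mathbb R^d$. Let $R$ be a $k\times d$ random matrix whose entries are i.i.d. copies of a zero-mean subgaussian random variable $X$ (that is, for some $\sigma^2>0$, $\mathrm E\, e^{\lambda X}\le e^{\sigma^2\lambda^2/2}$ for all $\lambda\in\mathbb R$), and let $\mathcal T^N=\{(x_n,y_n)\}_{n=1}^N$ be an i.i.d. sample from $\mathcal D$, independent of $R$. For $u\in\mathbb R^d$ let $\theta_u^h$ be the angle between $h$ and $u$ (with $\cos\theta_u^h=0$ if $h=0$ or $u=0$), and let $$f_k(\theta_u^h):=\Pr_R\{h^TR^TRu\le 0\},\qquad f_k^{\gamma}(\theta_u^h):=f_k(\theta_u^h)\cdot\mathbf 1(\cos\theta_u^h>\gamma).$$ Let $(\hat h_R,\hat b)$ be a compressive empirical risk minimizer, that is, a minimizer over $(w,b)\in\mathbb R^k\times\mathbb R$ of $\frac1N\sum_{n=1}^N\mathbf 1(\mathrm{sign}(w^TRx_n+b)\ne y_n)$, where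 $\mathrm{sign}(0)=0$. Then, for every $\delta\in(0,1)$, with probability at least $1-2\delta$ over the joint draw of $R$ and $\mathcal T^N$, every such minimizer satisfies $$\Pr_{(x,y)\sim\mathcal D}\{(\hat h_R^TRx+\hat b)\,y\le 0\}\le \frac1N\sum_{n=1}^N\mathbf 1\{\cos\theta^h_{x_ny_n}\le\gamma\}+c\sqrt{\frac{k+1+\log(1/\delta)}{N}}+\frac1N\sum_{n=1}^N f_k^{\gamma}(\theta^h_{x_ny_n})+\min\left\{\frac{1-\delta}{\delta}\cdot\frac1N\sum_{n=1}^N f_k^{\gamma}(\theta^h_{x_ny_n}),\ \sqrt{\tfrac12\log\tfrac1\delta}\right\}.$$ -/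

import Mathlib

open MeasureTheory ProbabilityTheory
open scoped BigOperators Matrix

noncomputable section

namespace CompressiveERM

/-- The original input space `ℝ^d` with its Euclidean structure. -/
abbrev Input (d : ℕ) : Type := EuclideanSpace ℝ (Fin d)

/-- The label set `{-1, 1}`. -/
abbrev Label : Type := ({-1, 1} : Set ℝ)

/-- A labelled observation `(x, y)`. -/
abbrev Obs (d : ℕ) : Type := Input d × Label

/-- The signed observation `u = y x`. -/
def signed {d : ℕ} (z : Obs d) : Input d := (z.2 : ℝ) • z.1

/-- `ρ` is the law of a zero-mean subgaussian real random variable: for some `σ² > 0`,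
`E exp (t X) ≤ exp (σ² t² / 2)` for all real `t` (with `exp (t X)` integrable). -/
def IsSubgaussianLaw (ρ : Measure ℝ) : Prop :=
  ∫ r, r ∂ρ = 0 ∧ ∃ σ2 : NNReal, 0 < σ2 ∧ HasSubgaussianMGF (fun r : ℝ => r) σ2 ρ

/-- Real `k × d` matrices, as families of entries with the product `σ`-algebra. -/
abbrev ProjMatrix (k d : ℕ) : Type := Fin k → Fin d → ℝ

/-- The law of a `k × d` random matrix with i.i.d. entries of law `ρ`. -/
def matrixLaw (ρ : Measure ℝ) (k d : ℕ) : Measure (ProjMatrix k d) :=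
  Measure.pi fun _ : Fin k => Measure.pi fun _ : Fin d => ρ

/-- The law of a training set of `N` i.i.d. observations of law `D`. -/
def sampleLaw {d : ℕ} (D : Measure (Obs d)) (N : ℕ) : Measure (Fin N → Obs d) :=
  Measure.pi fun _ : Fin N => D

/-- The projected vector `R x`. -/
def project {k d : ℕ} (R : ProjMatrix k d) (x : Input d) : Fin k → ℝ :=
  Matrix.of R *ᵥ x.ofLp

/-- The real-valued affine score `wᵀ R x + b` of an input `x` in the projected space. -/
def score {k d : ℕ} (R : ProjMatrix k d) (w : Fin k → ℝ) (b : ℝ) (x : Input d) : ℝ :=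
  w ⬝ᵥ project R x + b

/-- The zero-one loss of a prediction `p` at a label `y`. -/
def zeroOneLoss (p y : ℝ) : ℝ := if p ≠ y then 1 else 0

/-- The average zero-one loss of the classifier `sign (wᵀ R x + b)` on the projected sample;
here `sign 0 = 0`, so that a point on the decision boundary counts as an error. -/
def empiricalError {k d N : ℕ} (R : ProjMatrix k d) (S : Fin N → Obs d)
    (w : Fin k → ℝ) (b : ℝ) : ℝ :=
  (1 / (N : ℝ)) * ∑ n, zeroOneLoss (Real.sign (score R w b (S n).1)) (S n).2

/-- `(w, b)` is an empirical risk minimizer among all affine classifiers of the projected data. -/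
def IsCompressiveERM {k d N : ℕ} (R : ProjMatrix k d) (S : Fin N → Obs d)
    (w : Fin k → ℝ) (b : ℝ) : Prop :=
  ∀ (w' : Fin k → ℝ) (b' : ℝ), empiricalError R S w b ≤ empiricalError R S w' b'

/-- The generalization error `Pr_{(x,y) ∼ D} [(wᵀ R x + b) y ≤ 0]`, for fixed `R`, `w`, `b`. -/
def generalizationError {k d : ℕ} (D : Measure (Obs d)) (R : ProjMatrix k d)
    (w : Fin k → ℝ) (b : ℝ) : ℝ :=
  D.real {z | score R w b z.1 * (z.2 : ℝ) ≤ 0}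

/-- `cos θ`, with `θ` the angle between `h` and `u` (a right angle if `h = 0` or `u = 0`). -/
def cosAngle {d : ℕ} (h u : Input d) : ℝ := Real.cos (InnerProductGeometry.angle h u)

/-- The flipping probability `Pr_R [hᵀ Rᵀ R u ≤ 0]`. -/
def flipProb (ρ : Measure ℝ) (k : ℕ) {d : ℕ} (h u : Input d) : ℝ :=
  (matrixLaw ρ k d).real {R | project R h ⬝ᵥ project R u ≤ 0}

/-- The flipping probability, restricted to vectors `u` with `cos θ > γ`. -/
def flipProbMargin (ρ : Measure ℝ) (k : ℕ) (γ : ℝ) {d : ℕ} (h u : Input d) : ℝ :=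
  flipProb ρ k h u * (if γ < cosAngle h u then 1 else 0)

/-- The fraction of sample points with `cos θ ≤ γ`. -/
def marginError {d N : ℕ} (γ : ℝ) (h : Input d) (S : Fin N → Obs d) : ℝ :=
  (1 / (N : ℝ)) * ∑ n, if cosAngle h (signed (S n)) ≤ γ then 1 else 0

/-- The sample average of the restricted flipping probabilities. -/
def avgFlipProbMargin {d N : ℕ} (ρ : Measure ℝ) (k : ℕ) (γ : ℝ) (h : Input d)
    (S : Fin N → Obs d) : ℝ :=
  (1 / (N : ℝ)) * ∑ n, flipProbMargin ρ k γ h (signed (S n))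

end CompressiveERM

end

open CompressiveERM

/-! The empirical minimizer is compared with the projected classifier `(R h, 0)`, so its training
error is at most the training error of `R h`. That classifier errs at `(x, y)` only if `u = y x` has
cosine at most `γ` with `h`, or has larger cosine and is flipped by `R`. For a fixed sample, the
fraction of flipped points lies in `[0, 1]` and has mean over `R` equal to the average of `f_k^γ`.
The better of Markov's and Hoeffding's inequalities bounds it outside probability `δ`
(`measure_markov_hoeffding_le`).

The passage from training error to true error must hold for all `(w, b)` at once, with a rate free
of `log N`. In the features `y (1, R x)` an error means lying in a homogeneous halfspace, so `R` can
be fixed and halfspaces studied in dimension `k + 1`. Linear dependence bounds their VC dimension.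
Sauer–Shelah and random subsampling then bound the packing numbers by a quantity that depends on the
scale but not on the number of points (`log_card_le_of_separated`). Chaining over scales `4⁻ʲ`
(`card_signs_chaining`) sums Hoeffding's bounds into `√(N (m + L))`, up to a constant, outside
probability `exp (-L)`. A ghost sample with random swaps reduces the deviation to this finite count
of signs (`measure_pi_deviation_le_of_card_signs`). Rational halfspaces, with one extra coordinate
for an intercept, make the family countable, and Fubini restores the random `R`. -/

/-! ### VC dimension and packing numbers of halfspaces -/

/-- The trace on the points `p i` of the homogeneous halfspace `{x | v ⬝ᵥ x ≤ 0}`. -/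
noncomputable def halfspaceTrace {ι : Type*} [Fintype ι] {m : ℕ} (p : ι → Fin m → ℝ)
    (v : Fin m → ℝ) : Finset ι :=
  Finset.univ.filter fun i => v ⬝ᵥ p i ≤ 0

theorem mem_halfspaceTrace {ι : Type*} [Fintype ι] {m : ℕ} (p : ι → Fin m → ℝ)
    (v : Fin m → ℝ) (i : ι) : i ∈ halfspaceTrace p v ↔ v ⬝ᵥ p i ≤ 0 := by
  simp [halfspaceTrace]

/-- More than `m` points satisfy a linear relation. If a halfspace cut out exactly the points with
nonpositive coefficient, every term of the relation paired with `v` would be nonnegative and one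
positive, yet the sum is zero. -/
theorem card_le_of_shatters_halfspaceTrace {ι : Type*} [Fintype ι] [DecidableEq ι] {m : ℕ}
    (p : ι → Fin m → ℝ) (V : Finset (Fin m → ℝ)) (s : Finset ι)
    (hs : (V.image (halfspaceTrace p)).Shatters s) : s.card ≤ m := by
  by_contra! hlt
  have hdep : ¬ LinearIndependent ℝ (fun i : s => p i) := fun hli => by
    have := hli.fintype_card_le_finrank
    simp at this
    omega
  rw [Fintype.not_linearIndependent_iff] at hdep
  obtain ⟨g, hg, i₀, hi₀⟩ := hdep
  -- up to a sign, the relation has a positive coefficient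
  obtain ⟨g, hg, i₀, hi₀⟩ : ∃ g : s → ℝ, ∑ i, g i • p i = 0 ∧ ∃ i, 0 < g i := by
    rcases lt_or_gt_of_ne hi₀ with h | h
    · exact ⟨-g, by simpa using hg, i₀, by simpa using h⟩
    · exact ⟨g, hg, i₀, h⟩
  obtain ⟨u, hu, hsu⟩ := hs (t := s.filter fun i => ∃ h : i ∈ s, g ⟨i, h⟩ ≤ 0)
    (Finset.filter_subset _ _)
  obtain ⟨v, -, rfl⟩ := Finset.mem_image.1 hu
  have key : ∀ i : s, v ⬝ᵥ p i ≤ 0 ↔ g i ≤ 0 := by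
    intro i
    have := Finset.ext_iff.1 hsu i
    simpa [mem_halfspaceTrace] using this
  have h0 : ∑ i, g i * (v ⬝ᵥ p i) = 0 := by
    have := congrArg (fun x => v ⬝ᵥ x) hg
    simpa [dotProduct_sum] using this
  have hpos : 0 < ∑ i, g i * (v ⬝ᵥ p i) := by
    refine Finset.sum_pos' (fun i _ => ?_) ⟨i₀, Finset.mem_univ _, ?_⟩
    · rcases le_or_gt (g i) 0 with h | h
      · exact mul_nonneg_of_nonpos_of_nonpos h ((key i).2 h)
      · exact mul_nonneg h.le (not_le.1 fun h' => absurd ((key i).1 h') (not_le.2 h)).le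
    · exact mul_pos hi₀ (not_le.1 fun h' => absurd ((key i₀).1 h') (not_le.2 hi₀))
  exact hpos.ne' h0

/-- After multiplication by `x ^ m`, which is at most `x ^ i` for `i ≤ m`, the binomial theorem and
`1 + x ≤ exp x` suffice. The parameter `x` stays free so that the packing bound can tune it. -/
theorem sum_choose_le_exp (l m : ℕ) {x : ℝ} (hx : 0 < x) (hx1 : x ≤ 1) :
    (∑ i ∈ Finset.Iic m, (l.choose i : ℝ)) ≤ (1 / x) ^ m * Real.exp (x * l) := by
  have h1 : (∑ i ∈ Finset.Iic m, (l.choose i : ℝ)) * x ^ m ≤ (x + 1) ^ l := by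
    rw [Finset.sum_mul]
    calc ∑ i ∈ Finset.Iic m, (l.choose i : ℝ) * x ^ m
        ≤ ∑ i ∈ Finset.Iic m, (l.choose i : ℝ) * x ^ i := by
          refine Finset.sum_le_sum fun i hi => ?_
          exact mul_le_mul_of_nonneg_left
            (pow_le_pow_of_le_one hx.le hx1 (Finset.mem_Iic.1 hi)) (by positivity)
      _ ≤ ∑ i ∈ Finset.range (max l m + 1), (l.choose i : ℝ) * x ^ i := by
          refine Finset.sum_le_sum_of_subset_of_nonneg (fun i hi => ?_) fun _ _ _ => by positivity
          simp at hi ⊢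
          omega
      _ = ∑ i ∈ Finset.range (l + 1), (l.choose i : ℝ) * x ^ i := by
          symm
          refine Finset.sum_subset (fun i hi => ?_) fun i _ hi => ?_
          · simp at hi ⊢
            omega
          · rw [Nat.choose_eq_zero_of_lt (by simpa using hi)]
            simp
      _ = (x + 1) ^ l := by
          rw [add_pow]
          refine Finset.sum_congr rfl fun i _ => ?_
          simp [mul_comm]
  have h2 : (x + 1) ^ l ≤ Real.exp (x * l) := by
    rw [mul_comm, Real.exp_nat_mul]
    exact pow_le_pow_left₀ (by positivity) (Real.add_one_le_exp x) l
  rw [one_div, inv_pow, ← div_eq_inv_mul, le_div_iff₀ (by positivity)]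
  exact h1.trans h2

theorem card_le_of_injOn_halfspaceTrace {l m : ℕ} (p : Fin l → Fin m → ℝ)
    (V : Finset (Fin m → ℝ)) (hV : Set.InjOn (halfspaceTrace p) V) {x : ℝ} (hx : 0 < x)
    (hx1 : x ≤ 1) : (V.card : ℝ) ≤ (1 / x) ^ m * Real.exp (x * l) := by
  refine le_trans ?_ (sum_choose_le_exp l m hx hx1)
  have h1 : V.card ≤ ∑ i ∈ Finset.Iic (V.image (halfspaceTrace p)).vcDim, l.choose i := by
    rw [← Finset.card_image_of_injOn hV]
    refine (Finset.card_le_card_shatterer _).trans ?_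
    simpa using Finset.card_shatterer_le_sum_vcDim (𝒜 := V.image (halfspaceTrace p))
  have h2 : (V.image (halfspaceTrace p)).vcDim ≤ m :=
    Finset.sup_le fun s hs =>
      card_le_of_shatters_halfspaceTrace p V s (Finset.mem_shatterer.1 hs)
  have h3 := h1.trans (Finset.sum_le_sum_of_subset (Finset.Iic_subset_Iic.2 h2))
  exact_mod_cast h3

/-- The set of points on which two halfspaces differ. -/
noncomputable def traceDiff {ι : Type*} [Fintype ι] {m : ℕ} (p : ι → Fin m → ℝ)
    (v w : Fin m → ℝ) : Finset ι :=
  Finset.univ.filter fun i => ¬ (v ⬝ᵥ p i ≤ 0 ↔ w ⬝ᵥ p i ≤ 0)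

/-- Separated families of halfspaces are distinguished by few of the points. -/
theorem exists_sample_injOn {ι : Type*} [Fintype ι] [Nonempty ι] {m l : ℕ} (p : ι → Fin m → ℝ)
    (V : Finset (Fin m → ℝ)) {ε : ℝ}
    (hsep : ∀ v ∈ V, ∀ w ∈ V, v ≠ w → ε * Fintype.card ι ≤ (traceDiff p v w).card)
    (hl : (V.card : ℝ) ^ 2 * Real.exp (-(ε * l)) < 1) :
    ∃ s : Fin l → ι, Set.InjOn (halfspaceTrace (p ∘ s)) V := by
  classical
  by_contra! hno
  -- First-moment argument: a separated pair agrees on at most a fraction `(1 - ε) ^ l ≤ exp (-ε l)`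
  -- of the `l`-tuples, so fewer than all tuples fail for some pair.
  let agree : (Fin m → ℝ) × (Fin m → ℝ) → Finset (Fin l → ι) := fun q =>
    Fintype.piFinset fun _ => (traceDiff p q.1 q.2)ᶜ
  have hcover : (Finset.univ : Finset (Fin l → ι)) ⊆ V.offDiag.biUnion agree := by
    intro s _
    have h := hno s
    simp only [Set.InjOn, not_forall] at h
    obtain ⟨v, hv, w, hw, heq, hne⟩ := h
    refine Finset.mem_biUnion.2 ⟨(v, w), Finset.mem_offDiag.2 ⟨hv, hw, hne⟩, ?_⟩
    refine Fintype.mem_piFinset.2 fun i => ?_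
    have := Finset.ext_iff.1 heq i
    simpa [traceDiff, mem_halfspaceTrace] using this
  have hcard : ∀ q ∈ V.offDiag, ((agree q).card : ℝ)
      ≤ Real.exp (-(ε * l)) * (Fintype.card ι : ℝ) ^ l := by
    intro q hq
    obtain ⟨hv, hw, hne⟩ := Finset.mem_offDiag.1 hq
    have h1 := hsep _ hv _ hw hne
    have h2 : (((traceDiff p q.1 q.2)ᶜ.card : ℕ) : ℝ) ≤ Real.exp (-ε) * Fintype.card ι := by
      rw [Finset.card_compl, Nat.cast_sub (Finset.card_le_univ _)]
      have := Real.add_one_le_exp (-ε)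
      nlinarith [(Nat.cast_nonneg (Fintype.card ι) : (0 : ℝ) ≤ _)]
    simp only [agree, Fintype.card_piFinset, Finset.prod_const, Finset.card_univ, Fintype.card_fin]
    push_cast
    calc _ ≤ (Real.exp (-ε) * Fintype.card ι) ^ l := pow_le_pow_left₀ (by positivity) h2 l
      _ = _ := by
        rw [mul_pow, ← Real.exp_nat_mul]
        ring_nf
  have hn : (0 : ℝ) < (Fintype.card ι : ℝ) ^ l := by
    have : 0 < Fintype.card ι := Fintype.card_pos
    positivity
  have h1 : ((Fintype.card ι : ℝ)) ^ l ≤ ((V.offDiag.biUnion agree).card : ℝ) := by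
    have := Finset.card_le_card hcover
    simp only [Finset.card_univ, Fintype.card_fun, Fintype.card_fin] at this
    exact_mod_cast this
  have h2 : ((V.offDiag.biUnion agree).card : ℝ)
      ≤ (V.card : ℝ) ^ 2 * (Real.exp (-(ε * l)) * (Fintype.card ι : ℝ) ^ l) := by
    calc ((V.offDiag.biUnion agree).card : ℝ) ≤ ∑ q ∈ V.offDiag, ((agree q).card : ℝ) := by
          exact_mod_cast Finset.card_biUnion_le
      _ ≤ ∑ q ∈ V.offDiag, Real.exp (-(ε * l)) * (Fintype.card ι : ℝ) ^ l :=
          Finset.sum_le_sum hcard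
      _ = (V.offDiag.card : ℝ) * (Real.exp (-(ε * l)) * (Fintype.card ι : ℝ) ^ l) := by simp
      _ ≤ _ := by
          refine mul_le_mul_of_nonneg_right ?_ (by positivity)
          rw [Finset.offDiag_card]
          have : V.card * V.card - V.card ≤ V.card ^ 2 := by
            rw [sq]; exact Nat.sub_le _ _
          exact_mod_cast this
  nlinarith

/-- A packing bound for halfspaces. -/
theorem log_card_le_of_separated {ι : Type*} [Fintype ι] [Nonempty ι] {m : ℕ}
    (p : ι → Fin m → ℝ) (V : Finset (Fin m → ℝ)) {ε : ℝ} (hε : 0 < ε) (hε1 : ε ≤ 1)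
    (hsep : ∀ v ∈ V, ∀ w ∈ V, v ≠ w → ε * Fintype.card ι ≤ (traceDiff p v w).card) :
    Real.log V.card ≤ 4 / 3 * (m * Real.log (8 / ε) + 1 / 8) := by
  rcases V.eq_empty_or_nonempty with rfl | hne
  · have : 0 ≤ Real.log (8 / ε) := Real.log_nonneg (by rw [le_div_iff₀ hε]; linarith)
    simp
    positivity
  have hc1 : (1 : ℝ) ≤ V.card := by exact_mod_cast hne.card_pos
  have hc : (0 : ℝ) < V.card := by linarith
  have hlog : 0 ≤ Real.log V.card := Real.log_nonneg hc1
  -- The least order of `l` for which `|V|² exp (-ε l) < 1`; it depends on `|V|` and `ε`, not on the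
  -- number of points.
  set l : ℕ := ⌊2 * Real.log V.card / ε⌋₊ + 1 with hl
  have hl1 : 2 * Real.log V.card < ε * l := by
    have := Nat.lt_floor_add_one (2 * Real.log V.card / ε)
    rw [div_lt_iff₀ hε] at this
    rw [hl]
    push_cast
    linarith
  have hl2 : ε * l ≤ 2 * Real.log V.card + 1 := by
    have := Nat.floor_le (a := 2 * Real.log V.card / ε) (by positivity)
    rw [le_div_iff₀ hε] at this
    rw [hl]
    push_cast
    linarith
  obtain ⟨s, hs⟩ := exists_sample_injOn (l := l) p V hsep (by
    have : (V.card : ℝ) ^ 2 = Real.exp (2 * Real.log V.card) := by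
      rw [two_mul, Real.exp_add, Real.exp_log hc, sq]
    rw [this, ← Real.exp_add, Real.exp_lt_one_iff]
    linarith)
  -- With `x = ε / 8` the exponent `x l` is at most `(2 log |V| + 1) / 8`. A quarter of `log |V|` is
  -- absorbed on the left, whence the factor `4 / 3`.
  have h := card_le_of_injOn_halfspaceTrace (p ∘ s) V hs (x := ε / 8) (by positivity)
    (by linarith)
  have h' := Real.log_le_log hc h
  rw [Real.log_mul (by positivity) (Real.exp_pos _).ne', Real.log_exp, Real.log_pow,
    one_div_div] at h'
  nlinarith

/-! ### Hoeffding's inequality and chaining for Rademacher sums -/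

/-- The Rademacher sign of a Boolean. -/
def rademacherSign (b : Bool) : ℝ := if b then 1 else -1

/-- Hoeffding's inequality for Rademacher sums, as a count of sign vectors. -/
theorem card_signs_le_exp {α : Type*} [Fintype α] [DecidableEq α] (a : α → ℝ) {s A : ℝ}
    (hs : 0 < s) (hA : 0 ≤ A) (ha : ∑ i, a i ^ 2 ≤ s) :
    ((Finset.univ.filter fun σ : α → Bool =>
        √(2 * s * A) < ∑ i, rademacherSign (σ i) * a i).card : ℝ)
      ≤ 2 ^ Fintype.card α * Real.exp (-A) := by
  set t := √(2 * s * A) with ht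
  have ht2 : t ^ 2 = 2 * s * A := Real.sq_sqrt (by positivity)
  -- The optimal Chernoff parameter: the moment bound is `exp A` and the threshold contributes `exp
  -- (2 A)`.
  set c := t / s with hc
  have hc0 : 0 ≤ c := by positivity
  have h1 : ∑ σ : α → Bool, Real.exp (c * ∑ i, rademacherSign (σ i) * a i)
      ≤ 2 ^ Fintype.card α * Real.exp (c ^ 2 * s / 2) := by
    calc ∑ σ : α → Bool, Real.exp (c * ∑ i, rademacherSign (σ i) * a i)
        = ∏ i, ∑ b : Bool, Real.exp (c * (rademacherSign b * a i)) := by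
          rw [Finset.prod_univ_sum]
          simp only [Finset.mul_sum, Real.exp_sum]
          exact Finset.sum_congr (by ext; simp) fun _ _ => rfl
      _ = ∏ i, (2 * Real.cosh (c * a i)) := by
          refine Finset.prod_congr rfl fun i _ => ?_
          simp [rademacherSign, Real.cosh_eq]
          ring
      _ ≤ ∏ i, (2 * Real.exp ((c * a i) ^ 2 / 2)) := by
          refine Finset.prod_le_prod (fun i _ => by positivity) fun i _ => ?_
          exact mul_le_mul_of_nonneg_left (Real.cosh_le_exp_half_sq _) (by norm_num)
      _ = 2 ^ Fintype.card α * Real.exp (∑ i, (c * a i) ^ 2 / 2) := by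
          rw [Finset.prod_mul_distrib, Real.exp_sum]
          simp
      _ ≤ _ := by
          gcongr
          calc ∑ i, (c * a i) ^ 2 / 2 = c ^ 2 * (∑ i, a i ^ 2) / 2 := by
                rw [Finset.mul_sum, Finset.sum_div]
                exact Finset.sum_congr rfl fun i _ => by ring
            _ ≤ _ := by gcongr
  have h2 : ((Finset.univ.filter fun σ : α → Bool =>
        t < ∑ i, rademacherSign (σ i) * a i).card : ℝ) * Real.exp (c * t)
      ≤ ∑ σ : α → Bool, Real.exp (c * ∑ i, rademacherSign (σ i) * a i) := by
    rw [← nsmul_eq_mul]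
    refine (Finset.card_nsmul_le_sum _ _ _ fun σ hσ => ?_).trans
      (Finset.sum_le_sum_of_subset_of_nonneg (Finset.filter_subset _ _)
        fun _ _ _ => (Real.exp_pos _).le)
    refine Real.exp_le_exp.2 (mul_le_mul_of_nonneg_left ?_ hc0)
    exact (Finset.mem_filter.1 hσ).2.le
  have hct : c * t = 2 * A := by
    rw [hc]; field_simp; linarith
  have hcs : c ^ 2 * s / 2 = A := by
    rw [hc]; field_simp; linarith
  rw [hcs] at h1
  rw [hct] at h2
  have h3 := h2.trans h1
  rw [← le_div_iff₀ (Real.exp_pos _), mul_div_assoc, ← Real.exp_sub] at h3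
  rwa [show A - 2 * A = -A by ring] at h3

/-- The thresholds of the chaining links are proportional to these terms; their total is the
constant 6 there. -/
theorem sum_range_add_two_div_two_pow (J : ℕ) :
    ∑ j ∈ Finset.range J, ((j : ℝ) + 2) / 2 ^ j = 6 - 2 * (J + 3) / 2 ^ J := by
  induction J with
  | zero => norm_num
  | succ J ih =>
    rw [Finset.sum_range_succ, ih]
    push_cast
    field_simp
    ring

theorem sum_range_exp_neg_le_one (J : ℕ) :
    ∑ j ∈ Finset.range J, Real.exp (-((j : ℝ) + 1)) ≤ 1 := by
  have h : ∀ j : ℕ, Real.exp (-((j : ℝ) + 1)) ≤ 1 / 2 / 2 ^ j := by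
    intro j
    have h2 : (2 : ℝ) ≤ Real.exp 1 := by have := Real.add_one_le_exp (1 : ℝ); linarith
    have h3 : (2 : ℝ) ^ (j + 1) ≤ Real.exp ((j : ℝ) + 1) := by
      have := pow_le_pow_left₀ (by norm_num) h2 (j + 1)
      rwa [← Real.exp_nat_mul, mul_one, Nat.cast_add_one] at this
    rw [Real.exp_neg, div_div, one_div, ← pow_succ']
    exact inv_anti₀ (by positivity) h3
  have hs : ∑ j ∈ Finset.range J, (1 : ℝ) / 2 / 2 ^ j = 1 - 1 / 2 ^ J := by
    induction J with
    | zero => norm_num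
    | succ J ih =>
      rw [Finset.sum_range_succ, ih]
      field_simp
      ring
  refine (Finset.sum_le_sum fun j _ => h j).trans ?_
  rw [hs]
  have : (0 : ℝ) < 1 / 2 ^ J := by positivity
  linarith

open Classical in
/-- Dudley's chaining for Rademacher sums, as a count of sign vectors. -/
theorem card_signs_chaining {α V : Type*} [Fintype α] [DecidableEq α] (T : Set V)
    (a : V → α → ℝ) (P : ℕ → Finset V) (π : ℕ → V → V) {S B L : ℝ} (hS : 0 < S) (hB : 1 ≤ B)
    (hL : 0 ≤ L) (hπ : ∀ j, ∀ v ∈ T, π j v ∈ P j)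
    (hP : ∀ j : ℕ, ((P j).card : ℝ) ≤ Real.exp (B * (j + 1)))
    (hd : ∀ j, ∀ v ∈ T, ∑ i, (a (π (j + 1) v) i - a (π j v) i) ^ 2 ≤ S / 4 ^ j)
    (h0 : ∀ v ∈ T, a (π 0 v) = 0) (J : ℕ) (hJ : ∀ v ∈ T, a (π J v) = a v) :
    ((Finset.univ.filter fun σ : α → Bool =>
        ∃ v ∈ T, 6 * √(2 * S * (B + L)) < ∑ i, rademacherSign (σ i) * a v i).card : ℝ)
      ≤ 2 ^ Fintype.card α * Real.exp (-L) := by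
  -- Deviation exponent of link `j`: `B (2 j + 3)` pays for all pairs from two consecutive nets, `j
  -- + 1` makes the failure probabilities summable, and `L` is the required confidence.
  let A : ℕ → ℝ := fun j => B * (2 * j + 3) + L + (j + 1)
  let E : ℕ → V × V → Finset (α → Bool) := fun j q => Finset.univ.filter fun σ =>
    √(2 * (S / 4 ^ j) * A j) < ∑ i, rademacherSign (σ i) * (a q.1 i - a q.2 i)
  let Q : ℕ → Finset (V × V) := fun j => (P (j + 1) ×ˢ P j).filter fun q =>
    ∑ i, (a q.1 i - a q.2 i) ^ 2 ≤ S / 4 ^ j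
  have hA : ∀ j, 0 ≤ A j := fun j => by positivity
  have ht : ∀ j : ℕ, √(2 * (S / 4 ^ j) * A j) ≤ √(2 * S * (B + L)) * ((j + 2) / 2 ^ j) := by
    intro j
    rw [← Real.sqrt_sq (show (0 : ℝ) ≤ (j + 2) / 2 ^ j by positivity), ← Real.sqrt_mul (by positivity)]
    refine Real.sqrt_le_sqrt ?_
    have h4 : ((2 : ℝ) ^ j) ^ 2 = 4 ^ j := by rw [← pow_mul, mul_comm, pow_mul]; norm_num
    -- Growth of `A j` quadratic in `j + 2` is harmless, since the link's variance decays as `4⁻ʲ`.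
    have key : A j ≤ (B + L) * (j + 2) ^ 2 := by
      have hj : (0 : ℝ) ≤ j := by positivity
      simp only [A]
      nlinarith [mul_nonneg hj (sub_nonneg.2 hB), mul_nonneg hL hj, mul_nonneg hj hj,
        mul_nonneg (mul_nonneg hj hj) hL, mul_nonneg (mul_nonneg hj hj) (sub_nonneg.2 hB)]
    calc 2 * (S / 4 ^ j) * A j ≤ 2 * (S / 4 ^ j) * ((B + L) * (j + 2) ^ 2) := by gcongr
      _ = 2 * S * (B + L) * ((j + 2) / 2 ^ j) ^ 2 := by rw [div_pow, h4]; ring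
  have hcover : (Finset.univ.filter fun σ : α → Bool =>
        ∃ v ∈ T, 6 * √(2 * S * (B + L)) < ∑ i, rademacherSign (σ i) * a v i)
      ⊆ (Finset.range J).biUnion fun j => (Q j).biUnion (E j) := by
    intro σ hσ
    obtain ⟨v, hv, hlt⟩ := (Finset.mem_filter.1 hσ).2
    by_contra hno
    have hle : ∀ j ∈ Finset.range J, ∑ i, rademacherSign (σ i) * (a (π (j + 1) v) i - a (π j v) i)
        ≤ √(2 * S * (B + L)) * ((j + 2) / 2 ^ j) := by
      intro j hj
      refine le_trans ?_ (ht j)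
      by_contra! hgt
      refine hno (Finset.mem_biUnion.2 ⟨j, hj, Finset.mem_biUnion.2 ⟨(π (j + 1) v, π j v), ?_, ?_⟩⟩)
      · exact Finset.mem_filter.2 ⟨Finset.mem_product.2 ⟨hπ _ v hv, hπ _ v hv⟩, hd j v hv⟩
      · exact Finset.mem_filter.2 ⟨Finset.mem_univ _, hgt⟩
    have hsum : ∑ i, rademacherSign (σ i) * a v i
        = ∑ j ∈ Finset.range J, ∑ i, rademacherSign (σ i) * (a (π (j + 1) v) i - a (π j v) i) := by
      have := Finset.sum_range_sub (fun j => ∑ i, rademacherSign (σ i) * a (π j v) i) J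
      rw [h0 v hv, hJ v hv] at this
      simp only [Pi.zero_apply, mul_zero, Finset.sum_const_zero, sub_zero] at this
      rw [← this]
      refine Finset.sum_congr rfl fun j _ => ?_
      rw [← Finset.sum_sub_distrib]
      exact Finset.sum_congr rfl fun i _ => by ring
    have h6 : ∑ j ∈ Finset.range J, √(2 * S * (B + L)) * (((j : ℝ) + 2) / 2 ^ j)
        ≤ 6 * √(2 * S * (B + L)) := by
      rw [← Finset.mul_sum, sum_range_add_two_div_two_pow, mul_comm]
      refine mul_le_mul_of_nonneg_right ?_ (Real.sqrt_nonneg _)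
      have : (0 : ℝ) ≤ 2 * (J + 3) / 2 ^ J := by positivity
      linarith
    have := (Finset.sum_le_sum hle).trans h6
    rw [← hsum] at this
    linarith
  have hE : ∀ j, ∀ q ∈ Q j, ((E j q).card : ℝ) ≤ 2 ^ Fintype.card α * Real.exp (-A j) := by
    intro j q hq
    exact card_signs_le_exp (fun i => a q.1 i - a q.2 i) (by positivity) (hA j)
      (Finset.mem_filter.1 hq).2
  have hQ : ∀ j, ((Q j).card : ℝ) ≤ Real.exp (B * (2 * j + 3)) := by
    intro j
    calc ((Q j).card : ℝ) ≤ (P (j + 1)).card * (P j).card := by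
          rw [← Nat.cast_mul, ← Finset.card_product]
          exact_mod_cast Finset.card_filter_le _ _
      _ ≤ Real.exp (B * ((j + 1 : ℕ) + 1)) * Real.exp (B * (j + 1)) := by
          gcongr
          · exact hP _
          · exact hP _
      _ = _ := by
          rw [← Real.exp_add]
          push_cast
          ring_nf
  calc _ ≤ (((Finset.range J).biUnion fun j => (Q j).biUnion (E j)).card : ℝ) := by
        exact_mod_cast Finset.card_le_card hcover
    _ ≤ ∑ j ∈ Finset.range J, (((Q j).biUnion (E j)).card : ℝ) := by
        exact_mod_cast Finset.card_biUnion_le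
    _ ≤ ∑ j ∈ Finset.range J,
          2 ^ Fintype.card α * Real.exp (-L) * Real.exp (-((j : ℝ) + 1)) := by
        refine Finset.sum_le_sum fun j _ => ?_
        calc (((Q j).biUnion (E j)).card : ℝ) ≤ ∑ q ∈ Q j, ((E j q).card : ℝ) := by
              exact_mod_cast Finset.card_biUnion_le
          _ ≤ ∑ q ∈ Q j, 2 ^ Fintype.card α * Real.exp (-A j) := Finset.sum_le_sum (hE j)
          _ = (Q j).card * (2 ^ Fintype.card α * Real.exp (-A j)) := by simp
          _ ≤ Real.exp (B * (2 * j + 3)) * (2 ^ Fintype.card α * Real.exp (-A j)) :=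
              mul_le_mul_of_nonneg_right (hQ j) (by positivity)
          _ = 2 ^ Fintype.card α * (Real.exp (B * (2 * j + 3)) * Real.exp (-A j)) := by ring
          _ = _ := by
              rw [mul_assoc, ← Real.exp_add, ← Real.exp_add]
              simp only [A]
              ring_nf
    _ ≤ _ := by
        rw [← Finset.mul_sum]
        exact mul_le_of_le_one_right (by positivity) (sum_range_exp_neg_le_one J)

/-! ### Chaining applied to halfspaces -/

/-- Existence of a maximal separated subset. -/
theorem exists_separated_net {V : Type*} (T : Finset V) (d : V → V → ℝ)
    (hself : ∀ v, d v v = 0) (hsymm : ∀ v w, d v w = d w v) {r : ℝ} (hr : 0 < r) :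
    ∃ P : Finset V, (∀ v ∈ P, ∀ w ∈ P, v ≠ w → r ≤ d v w) ∧ ∀ v ∈ T, ∃ w ∈ P, d v w < r := by
  classical
  induction T using Finset.induction_on with
  | empty => exact ⟨∅, by simp, by simp⟩
  | insert x T _ ih =>
    obtain ⟨P, hP, hT⟩ := ih
    by_cases hx : ∃ w ∈ P, d x w < r
    · exact ⟨P, hP, fun v hv => (Finset.mem_insert.1 hv).elim (fun h => h ▸ hx) (hT v)⟩
    · push Not at hx
      refine ⟨insert x P, fun v hv w hw hne => ?_, fun v hv => ?_⟩
      · rcases Finset.mem_insert.1 hv with rfl | hv <;> rcases Finset.mem_insert.1 hw with rfl | hw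
        · exact absurd rfl hne
        · exact hx w hw
        · rw [hsymm]
          exact hx v ‹v ∈ P›
        · exact hP v hv w hw hne
      · rcases Finset.mem_insert.1 hv with rfl | hv
        · exact ⟨v, Finset.mem_insert_self _ _, by rw [hself]; exact hr⟩
        · obtain ⟨w, hw, h⟩ := hT v hv
          exact ⟨w, Finset.mem_insert_of_mem hw, h⟩

theorem traceDiff_self {ι : Type*} [Fintype ι] {m : ℕ} (p : ι → Fin m → ℝ) (v : Fin m → ℝ) :
    traceDiff p v v = ∅ := by
  simp [traceDiff]

theorem traceDiff_comm {ι : Type*} [Fintype ι] {m : ℕ} (p : ι → Fin m → ℝ) (v w : Fin m → ℝ) :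
    traceDiff p v w = traceDiff p w v := by
  ext i
  simp only [traceDiff, Finset.mem_filter]
  tauto

theorem card_traceDiff_triangle {ι : Type*} [Fintype ι] {m : ℕ} (p : ι → Fin m → ℝ)
    (u v w : Fin m → ℝ) :
    (traceDiff p u w).card ≤ (traceDiff p u v).card + (traceDiff p v w).card := by
  classical
  refine le_trans (Finset.card_le_card fun i hi => ?_) (Finset.card_union_le _ _)
  simp only [traceDiff, Finset.mem_filter, Finset.mem_union] at hi ⊢
  tauto

/-- The indicator of the homogeneous halfspace `{x | v ⬝ᵥ x ≤ 0}`. -/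
noncomputable def halfspaceInd {m : ℕ} (v x : Fin m → ℝ) : ℝ := if v ⬝ᵥ x ≤ 0 then 1 else 0

/-- This is `(a - b)² ≤ 2 (a² + b²)` for differences of indicators. It turns Hamming distance on the
double sample into the variance needed by Hoeffding. -/
theorem sum_sq_halfspaceInd_sub_le {α : Type*} [Fintype α] {m : ℕ} (x y : α → Fin m → ℝ)
    (v w : Fin m → ℝ) :
    ∑ i, ((halfspaceInd v (y i) - halfspaceInd v (x i))
        - (halfspaceInd w (y i) - halfspaceInd w (x i))) ^ 2
      ≤ 2 * (traceDiff (Sum.elim x y) v w).card := by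
  rw [traceDiff, Finset.card_filter, Fintype.sum_sum_type]
  push_cast
  rw [← Finset.sum_add_distrib, Finset.mul_sum]
  refine Finset.sum_le_sum fun i _ => ?_
  simp only [Sum.elim_inl, Sum.elim_inr, halfspaceInd]
  by_cases h1 : v ⬝ᵥ x i ≤ 0 <;> by_cases h2 : w ⬝ᵥ x i ≤ 0 <;>
    by_cases h3 : v ⬝ᵥ y i ≤ 0 <;> by_cases h4 : w ⬝ᵥ y i ≤ 0 <;>
    simp only [h1, h2, h3, h4] <;> norm_num

-- The nets have Hamming radius `4⁻ʲ` relative to the `2 N` points, that is, `ℓ²` radius of order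
-- `2⁻ʲ`. Their entropy grows only linearly in `j`, so the sum over scales converges and no `log N`
-- appears.
open Classical in
theorem card_signs_halfspace_le {α : Type*} [Fintype α] [DecidableEq α] [Nonempty α] {m : ℕ}
    (hm : 0 < m) (x y : α → Fin m → ℝ) (V : Finset (Fin m → ℝ)) {L : ℝ} (hL : 0 ≤ L) :
    ((Finset.univ.filter fun σ : α → Bool =>
        ∃ v ∈ V, 24 * √(Fintype.card α * (3 * m + L)) <
          ∑ i, rademacherSign (σ i) * (halfspaceInd v (y i) - halfspaceInd v (x i))).card : ℝ)
      ≤ 2 ^ Fintype.card α * Real.exp (-L) := by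
  set N := Fintype.card α with hN
  have hN0 : 0 < N := Fintype.card_pos
  have hN0' : (0 : ℝ) < N := by exact_mod_cast hN0
  have hm1 : (1 : ℝ) ≤ m := by exact_mod_cast hm
  let p : α ⊕ α → Fin m → ℝ := Sum.elim x y
  have hn : (Fintype.card (α ⊕ α) : ℝ) = 2 * N := by
    rw [Fintype.card_sum, ← hN]; push_cast; ring
  let d : (Fin m → ℝ) → (Fin m → ℝ) → ℝ := fun v w => (traceDiff p v w).card
  have hnet : ∀ j : ℕ, ∃ (P : Finset (Fin m → ℝ)) (π : (Fin m → ℝ) → Fin m → ℝ),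
      (∀ v ∈ V, π v ∈ P) ∧ (P.card : ℝ) ≤ Real.exp (3 * m * (j + 1))
        ∧ (∀ v ∈ V, d v (π v) ≤ 2 * N / 4 ^ j) ∧ (j = 0 → ∀ v ∈ V, π v = 0) := by
    intro j
    rcases Nat.eq_zero_or_pos j with rfl | hj
    -- The coarsest net is the zero vector: its halfspace is the whole space, so its increments
    -- vanish and the chain starts at zero.
    · refine ⟨{0}, fun _ => 0, by simp, ?_, fun v _ => ?_, by simp⟩
      · simp
      · rw [pow_zero, div_one, ← hn]
        exact Nat.cast_le.2 (Finset.card_le_univ (traceDiff p v 0))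
    · obtain ⟨P, hP, hcov⟩ := exists_separated_net V d (fun v => by simp [d, traceDiff_self])
        (fun v w => by simp [d, traceDiff_comm p v w])
        (r := 1 / 4 ^ j * Fintype.card (α ⊕ α)) (by rw [hn]; positivity)
      choose! π hπ hπd using hcov
      refine ⟨P, π, hπ, ?_, fun v hv => ?_, fun h => absurd h hj.ne'⟩
      · have hlog := log_card_le_of_separated p P (ε := 1 / 4 ^ j) (by positivity)
          (by rw [div_le_one (by positivity)]; exact one_le_pow₀ (by norm_num)) hP
        have h8 : Real.log (8 / (1 / 4 ^ j)) = (3 + 2 * j) * Real.log 2 := by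
          rw [div_div_eq_mul_div, div_one, Real.log_mul (by norm_num) (by positivity),
            Real.log_pow, show (8 : ℝ) = 2 ^ 3 by norm_num, show (4 : ℝ) = 2 ^ 2 by norm_num,
            Real.log_pow, Real.log_pow]
          push_cast
          ring
        rw [h8] at hlog
        refine (Real.le_exp_log _).trans (Real.exp_le_exp.2 (hlog.trans ?_))
        have hl2 := Real.log_two_lt_d9
        have hj0 : (0 : ℝ) ≤ j := by positivity
        have hb : (3 + 2 * (j : ℝ)) * Real.log 2 ≤ (3 + 2 * j) * 0.6932 := by
          refine mul_le_mul_of_nonneg_left (by linarith) (by positivity)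
        have hb' := mul_le_mul_of_nonneg_left hb (by positivity : (0 : ℝ) ≤ m)
        nlinarith [mul_nonneg hj0 (sub_nonneg.2 hm1)]
      · refine (hπd v hv).le.trans_eq ?_
        rw [hn]
        ring
  choose P π hπ hP hπd hπ0 using hnet
  -- At this scale the Hamming distance is below one, so the net point has the same trace as `v`.
  obtain ⟨J, hJ⟩ := pow_unbounded_of_one_lt (2 * N : ℝ) (by norm_num : (1 : ℝ) < 4)
  let a : (Fin m → ℝ) → α → ℝ := fun v i => halfspaceInd v (y i) - halfspaceInd v (x i)
  have ha : ∀ v w, ∑ i, (a v i - a w i) ^ 2 ≤ 2 * d v w := fun v w =>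
    sum_sq_halfspaceInd_sub_le x y v w
  -- Two consecutive net points are within `4 N / 4 ^ j`; the factor 2 from squares gives `S = 8 N`,
  -- and `6 √16 = 24`.
  have h := card_signs_chaining (V : Set (Fin m → ℝ)) a P π (S := 8 * N) (B := 3 * m) (L := L)
    (by positivity) (by linarith) hL hπ hP (fun j v hv => ?_) (fun v hv => ?_) J (fun v hv => ?_)
  · have : 2 * (8 * (N : ℝ)) * (3 * m + L) = 4 ^ 2 * (N * (3 * m + L)) := by ring
    rw [this, Real.sqrt_mul (by norm_num), Real.sqrt_sq (by norm_num), ← mul_assoc] at h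
    norm_num only at h
    exact h
  · refine (ha _ _).trans ?_
    have h1 : d (π (j + 1) v) (π j v) ≤ d (π (j + 1) v) v + d v (π j v) := by
      simp only [d]
      exact_mod_cast card_traceDiff_triangle p _ _ _
    have h2 := hπd j v hv
    have h3 := hπd (j + 1) v hv
    have h4 : d (π (j + 1) v) v = d v (π (j + 1) v) := by simp [d, traceDiff_comm p v]
    have h5 : 2 * (N : ℝ) / 4 ^ (j + 1) ≤ 2 * N / 4 ^ j := by
      gcongr
      · norm_num
      · omega
    calc 2 * d (π (j + 1) v) (π j v) ≤ 2 * (2 * N / 4 ^ j + 2 * N / 4 ^ j) := by linarith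
      _ = 8 * N / 4 ^ j := by ring
  · rw [hπ0 0 rfl v hv]
    ext i
    simp [a, halfspaceInd]
  · have h1 : d v (π J v) < 1 := (hπd J v hv).trans_lt (by rwa [div_lt_one (by positivity)])
    have h2 : d v (π J v) = 0 := by
      have : (traceDiff p v (π J v)).card < 1 := by
        simp only [d] at h1
        exact_mod_cast h1
      simp only [d, Nat.lt_one_iff.1 this, Nat.cast_zero]
    have h3 := ha v (π J v)
    rw [h2, mul_zero] at h3
    have h4 := (Finset.sum_eq_zero_iff_of_nonneg (fun i _ => sq_nonneg _)).1
      (le_antisymm h3 (Finset.sum_nonneg fun i _ => sq_nonneg _))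
    ext i
    have := h4 i (Finset.mem_univ _)
    rw [sq_eq_zero_iff] at this
    linarith

/-! ### Symmetrization by a ghost sample -/

/-- A ghost sample is unlikely to fall short of its mean by a constant number of standard
deviations. -/
theorem measure_pi_sum_le_half {Z α : Type*} [MeasurableSpace Z] [Fintype α] (D : Measure Z)
    [IsProbabilityMeasure D] {g : Z → ℝ} (hg : Measurable g) (h01 : ∀ z, g z ∈ Set.Icc (0 : ℝ) 1)
    {u : ℝ} (hu : 0 < u) (hu2 : (Fintype.card α : ℝ) / 2 ≤ u ^ 2) :
    (Measure.pi fun _ : α => D) {S | ∑ i, g (S i) ≤ Fintype.card α * ∫ z, g z ∂D - u}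
      ≤ ENNReal.ofReal (1 / 2) := by
  have hLp : MemLp g 2 D := memLp_of_bounded (ae_of_all _ h01) hg.aestronglyMeasurable 2
  have hint : Integrable g D := hLp.integrable (by norm_num)
  have hLpS : MemLp (∑ i : α, fun S : α → Z => g (S i)) 2 (Measure.pi fun _ : α => D) :=
    memLp_finsetSum' _ fun i _ =>
      hLp.comp_measurePreserving (measurePreserving_eval (fun _ : α => D) i)
  have hmean : ∫ S, (∑ i : α, fun S : α → Z => g (S i)) S ∂(Measure.pi fun _ : α => D)
      = Fintype.card α * ∫ z, g z ∂D := by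
    simp only [Finset.sum_apply]
    have hint' : ∀ i : α, Integrable (fun S : α → Z => g (S i)) (Measure.pi fun _ : α => D) :=
      fun i => (measurePreserving_eval (fun _ : α => D) i).integrable_comp_of_integrable hint
    rw [integral_finsetSum _ fun i _ => hint' i]
    have : ∀ i : α, ∫ S : α → Z, g (S i) ∂(Measure.pi fun _ : α => D) = ∫ z, g z ∂D := fun i => by
      rw [← (measurePreserving_eval (fun _ : α => D) i).map_eq,
        integral_map (measurable_pi_apply i).aemeasurable hg.aestronglyMeasurable]
      simp [(measurePreserving_eval (fun _ : α => D) i).map_eq]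
    simp [this]
  have hvar : Var[∑ i : α, fun S : α → Z => g (S i); Measure.pi fun _ : α => D]
      ≤ Fintype.card α / 4 := by
    rw [variance_sum_pi (X := fun _ : α => g) (μ := fun _ : α => D) fun _ => hLp]
    have h1 : Var[g; D] ≤ 1 / 4 := by
      have := variance_le_sq_of_bounded (ae_of_all D h01) hg.aemeasurable
      norm_num at this
      linarith
    calc ∑ _i : α, Var[g; D] = Fintype.card α * Var[g; D] := by simp
      _ ≤ Fintype.card α * (1 / 4) := by gcongr
      _ = _ := by ring
  refine (measure_mono fun S hS => ?_).trans ((meas_ge_le_variance_div_sq hLpS hu).trans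
    (ENNReal.ofReal_le_ofReal ?_))
  · rw [Set.mem_ofPred_eq] at hS ⊢
    rw [hmean, Finset.sum_apply]
    rw [abs_sub_comm]
    exact le_trans (by linarith) (le_abs_self _)
  · rw [div_le_iff₀ (by positivity)]
    linarith

/-- Swapping the two halves of a double sample at the indices marked by `σ`. -/
theorem measurePreserving_swap_pi {Z α : Type*} [MeasurableSpace Z] [Fintype α] (D : Measure Z)
    [IsProbabilityMeasure D] (σ : α → Bool) :
    MeasurePreserving (fun (z : α → Z × Z) i => if σ i then z i else (z i).swap)
      (Measure.pi fun _ : α => D.prod D) (Measure.pi fun _ : α => D.prod D) := by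
  refine measurePreserving_pi (f := fun i (p : Z × Z) => if σ i then p else p.swap) _ _
    fun i => ?_
  cases σ i
  · simpa using Measure.measurePreserving_swap
  · exact MeasurePreserving.id _

open Classical in
/-- Symmetrization: a bound on the number of sign vectors with a large signed sum, valid for every
double sample, bounds the probability of a large one-sided deviation. -/
theorem measure_pi_deviation_le_of_card_signs {Z α V : Type*} [MeasurableSpace Z] [Fintype α]
    (D : Measure Z) [IsProbabilityMeasure D] (T : Finset V) (g : V → Z → ℝ)
    (hg : ∀ v, Measurable (g v)) (h01 : ∀ v z, g v z ∈ Set.Icc (0 : ℝ) 1) {u κ : ℝ} (hu : 0 < u)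
    (hu2 : (Fintype.card α : ℝ) / 2 ≤ u ^ 2)
    (hcard : ∀ x y : α → Z, ((Finset.univ.filter fun σ : α → Bool => ∃ v ∈ T,
        u < ∑ i, rademacherSign (σ i) * (g v (y i) - g v (x i))).card : ℝ)
      ≤ 2 ^ Fintype.card α * κ) :
    (Measure.pi fun _ : α => D)
        {S | ∃ v ∈ T, 2 * u < Fintype.card α * ∫ z, g v z ∂D - ∑ i, g v (S i)}
      ≤ ENNReal.ofReal (2 * κ) := by
  set P := Measure.pi fun _ : α => D with hP
  set Q := Measure.pi fun _ : α => D.prod D with hQ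
  set bad := {S : α → Z | ∃ v ∈ T, 2 * u < Fintype.card α * ∫ z, g v z ∂D - ∑ i, g v (S i)}
  let E : Set ((α → Z) × (α → Z)) := {q | ∃ v ∈ T, u < ∑ i, (g v (q.2 i) - g v (q.1 i))}
  let F : (α → Bool) → Set (α → Z × Z) := fun σ =>
    {z | ∃ v ∈ T, u < ∑ i, rademacherSign (σ i) * (g v (z i).2 - g v (z i).1)}
  have hE : MeasurableSet E := by
    have : E = ⋃ v ∈ T, {q | u < ∑ i, (g v (q.2 i) - g v (q.1 i))} := by ext; simp [E]
    rw [this]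
    refine Finset.measurableSet_biUnion _ fun v _ => measurableSet_lt measurable_const ?_
    have := hg v
    fun_prop
  have hF : ∀ σ, MeasurableSet (F σ) := fun σ => by
    have : F σ = ⋃ v ∈ T,
        {z | u < ∑ i, rademacherSign (σ i) * (g v (z i).2 - g v (z i).1)} := by ext; simp [F]
    rw [this]
    refine Finset.measurableSet_biUnion _ fun v _ => measurableSet_lt measurable_const ?_
    have := hg v
    fun_prop
  have hbad : MeasurableSet bad := by
    have : bad = ⋃ v ∈ T, {S | 2 * u < Fintype.card α * ∫ z, g v z ∂D - ∑ i, g v (S i)} := by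
      ext; simp [bad]
    rw [this]
    refine Finset.measurableSet_biUnion _ fun v _ => measurableSet_lt measurable_const ?_
    have := hg v
    fun_prop
  -- For a bad sample, some `v` falls short by more than `2 u`. With probability at least one half
  -- the ghost sample falls short by less than `u` for this same `v`, so the two samples differ by
  -- more than `u`.
  have hghost : ENNReal.ofReal (1 / 2) * P bad ≤ (P.prod P) E := by
    rw [Measure.prod_apply hE, ← setLIntegral_const]
    refine (setLIntegral_mono' hbad fun S hS => ?_).trans (setLIntegral_le_lintegral _ _)
    obtain ⟨v, hv, hlt⟩ := hS
    have hsmall := measure_pi_sum_le_half (α := α) D (hg v) (h01 v) hu hu2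
    have hm : MeasurableSet {S' : α → Z | ∑ i, g v (S' i) ≤ Fintype.card α * ∫ z, g v z ∂D - u} := by
      have := hg v
      exact measurableSet_le (by fun_prop) measurable_const
    have hcompl : ENNReal.ofReal (1 / 2)
        ≤ P {S' : α → Z | ∑ i, g v (S' i) ≤ Fintype.card α * ∫ z, g v z ∂D - u}ᶜ := by
      rw [prob_compl_eq_one_sub hm]
      refine le_trans ?_ (tsub_le_tsub_left hsmall _)
      rw [← ENNReal.ofReal_one, ← ENNReal.ofReal_sub _ (by norm_num)]
      norm_num
    refine hcompl.trans (measure_mono fun S' hS' => ⟨v, hv, ?_⟩)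
    simp only [Set.mem_compl_iff, Set.mem_ofPred_eq, not_le] at hS'
    rw [Finset.sum_sub_distrib]
    simp only
    linarith
  have hEQ : (P.prod P) E = Q (F fun _ => true) := by
    rw [← (measurePreserving_arrowProdEquivProdArrow Z Z α (fun _ => D)
      (fun _ => D)).measure_preimage hE.nullMeasurableSet]
    congr 1
    ext z
    simp [E, F, rademacherSign, MeasurableEquiv.arrowProdEquivProdArrow,
      Equiv.arrowProdEquivProdArrow]
  have hswap : ∀ σ, Q (F σ) = Q (F fun _ => true) := fun σ => by
    rw [← (measurePreserving_swap_pi D σ).measure_preimage (hF _).nullMeasurableSet]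
    congr 1
    ext z
    simp only [F, Set.mem_ofPred_eq, Set.mem_preimage]
    have : ∀ v i, rademacherSign (σ i) *
        (g v (if σ i then z i else (z i).swap).2 - g v (if σ i then z i else (z i).swap).1)
          = rademacherSign true * (g v (z i).2 - g v (z i).1) := by
      intro v i
      cases σ i <;> simp [rademacherSign]
    simp only [this]
  -- All sign patterns have equal probability, so averaging over them inside the integral lets
  -- `hcard` apply to each double sample separately.
  have havg : (2 : ENNReal) ^ Fintype.card α * Q (F fun _ => true)
      ≤ 2 ^ Fintype.card α * ENNReal.ofReal κ := by
    calc (2 : ENNReal) ^ Fintype.card α * Q (F fun _ => true)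
        = ∑ σ : α → Bool, Q (F σ) := by
          simp [hswap]
      _ = ∑ σ : α → Bool, ∫⁻ z, (F σ).indicator 1 z ∂Q := by
          simp only [lintegral_indicator_one (hF _)]
      _ = ∫⁻ z, ∑ σ : α → Bool, (F σ).indicator 1 z ∂Q :=
          (lintegral_finsetSum _ fun σ _ => measurable_one.indicator (hF σ)).symm
      _ ≤ ∫⁻ _, ENNReal.ofReal (2 ^ Fintype.card α * κ) ∂Q := by
          refine lintegral_mono fun z => ?_
          have h := hcard (fun i => (z i).1) (fun i => (z i).2)
          have : ∑ σ : α → Bool, (F σ).indicator (1 : (α → Z × Z) → ENNReal) z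
              = ((Finset.univ.filter fun σ : α → Bool => ∃ v ∈ T,
                u < ∑ i, rademacherSign (σ i) * (g v (z i).2 - g v (z i).1)).card : ENNReal) := by
            rw [Finset.card_filter]
            push_cast
            exact Finset.sum_congr rfl fun σ _ => by simp [Set.indicator_apply, F]
          rw [this, ← ENNReal.ofReal_natCast]
          exact ENNReal.ofReal_le_ofReal h
      _ = _ := by
          rw [lintegral_const, measure_univ, mul_one, ENNReal.ofReal_mul (by positivity),
            ENNReal.ofReal_pow (by norm_num), ENNReal.ofReal_ofNat]
  have hfin : Q (F fun _ => true) ≤ ENNReal.ofReal κ :=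
    (ENNReal.mul_le_mul_iff_right (by positivity) (by finiteness)).1 havg
  have h := hghost.trans (hEQ.trans_le hfin)
  calc P bad = 2 * (ENNReal.ofReal (1 / 2) * P bad) := by
        rw [← mul_assoc, ← ENNReal.ofReal_ofNat, ← ENNReal.ofReal_mul (by norm_num)]
        norm_num
    _ ≤ 2 * ENNReal.ofReal κ := by gcongr
    _ = _ := by rw [ENNReal.ofReal_mul (by norm_num), ENNReal.ofReal_ofNat]

/-! ### Uniform deviation: from finite families to all halfspaces -/

theorem measurable_halfspaceInd {m : ℕ} (v : Fin m → ℝ) : Measurable (halfspaceInd v) := by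
  unfold halfspaceInd
  refine Measurable.ite (measurableSet_le ?_ measurable_const) measurable_const measurable_const
  unfold dotProduct
  fun_prop

theorem halfspaceInd_mem_Icc {m : ℕ} (v x : Fin m → ℝ) : halfspaceInd v x ∈ Set.Icc (0 : ℝ) 1 := by
  unfold halfspaceInd
  split_ifs <;> simp

/-- The uniform one-sided deviation bound for a countable family of homogeneous halfspaces, without
a logarithmic factor in the sample size. -/
theorem measure_pi_halfspace_deviation_le {Z α I : Type*} [MeasurableSpace Z] [Fintype α]
    [Nonempty α] [Countable I] (D : Measure Z) [IsProbabilityMeasure D] {m : ℕ} (hm : 0 < m)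
    (v : I → Fin m → ℝ) {φ : Z → Fin m → ℝ} (hφ : Measurable φ) {L : ℝ} (hL : 0 ≤ L) :
    (Measure.pi fun _ : α => D)
        {S | ∃ i, 48 * √(Fintype.card α * (3 * m + L)) <
          Fintype.card α * ∫ z, halfspaceInd (v i) (φ z) ∂D - ∑ n, halfspaceInd (v i) (φ (S n))}
      ≤ ENNReal.ofReal (2 * Real.exp (-L)) := by
  classical
  set N := Fintype.card α with hN
  have hN1 : (1 : ℝ) ≤ N := by exact_mod_cast (Fintype.card_pos : 0 < Fintype.card α)
  have hm1 : (1 : ℝ) ≤ m := by exact_mod_cast hm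
  set bad : Finset I → Set (α → Z) := fun T => {S | ∃ i ∈ T, 48 * √(N * (3 * m + L)) <
    N * ∫ z, halfspaceInd (v i) (φ z) ∂D - ∑ n, halfspaceInd (v i) (φ (S n))} with hbad
  have hunion : {S : α → Z | ∃ i, 48 * √(N * (3 * m + L)) <
      N * ∫ z, halfspaceInd (v i) (φ z) ∂D - ∑ n, halfspaceInd (v i) (φ (S n))} = ⋃ T, bad T := by
    ext S
    simp only [Set.mem_ofPred_eq, Set.mem_iUnion, hbad]
    exact ⟨fun ⟨i, hi⟩ => ⟨{i}, i, by simp, hi⟩, fun ⟨_, i, _, hi⟩ => ⟨i, hi⟩⟩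
  have hmono : Monotone bad := fun T T' h S ⟨i, hi, hlt⟩ => ⟨i, h hi, hlt⟩
  -- The finite bound does not depend on the subfamily, so it survives the increasing union.
  rw [hunion, hmono.directed_le.measure_iUnion]
  refine iSup_le fun T => ?_
  have hsq : √(N * (3 * m + L)) ^ 2 = N * (3 * m + L) := Real.sq_sqrt (by positivity)
  have h := measure_pi_deviation_le_of_card_signs (α := α) D T
    (fun i z => halfspaceInd (v i) (φ z)) (fun i => (measurable_halfspaceInd _).comp hφ)
    (fun i z => halfspaceInd_mem_Icc _ _) (u := 24 * √(N * (3 * m + L))) (κ := Real.exp (-L))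
    (by positivity) (by rw [mul_pow, hsq, ← hN]; nlinarith) fun x y => ?_
  · rw [← mul_assoc] at h
    norm_num only at h
    exact h
  · refine le_trans (le_of_eq ?_) (card_signs_halfspace_le hm (fun i => φ (x i))
      (fun i => φ (y i)) (T.image v) hL)
    congr 2
    ext σ
    simp [← hN]

/-- A homogeneous halfspace is a pointwise limit of affine halfspaces with rational data. -/
theorem exists_rat_halfspace_tendsto {m : ℕ} (v : Fin m → ℝ) :
    ∃ q : ℕ → Fin m → ℚ, ∀ x : Fin m → ℝ, ∀ᶠ j : ℕ in Filter.atTop,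
      halfspaceInd (Matrix.vecCons ((1 / (j + 1) : ℚ) : ℝ) fun i => (q j i : ℝ))
        (Matrix.vecCons (-1) x) = halfspaceInd v x := by
  -- The error must be of smaller order than the intercept `1 / (j + 1)`: this slack keeps boundary
  -- points, where `v ⬝ᵥ x = 0`, inside the approximating halfspaces.
  have hex : ∀ (j : ℕ) (i : Fin m), ∃ q : ℚ, |v i - q| < 1 / ((j : ℝ) + 1) ^ 2 :=
    fun j i => exists_rat_near _ (by positivity)
  choose q hq using hex
  refine ⟨q, fun x => ?_⟩
  have hdiff : ∀ j, |v ⬝ᵥ x - (fun i => (q j i : ℝ)) ⬝ᵥ x| ≤ (∑ i, |x i|) / ((j : ℝ) + 1) ^ 2 := by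
    intro j
    rw [← sub_dotProduct, Finset.sum_div]
    refine (Finset.abs_sum_le_sum_abs _ _).trans (Finset.sum_le_sum fun i _ => ?_)
    rw [abs_mul, div_eq_mul_one_div, mul_comm]
    exact mul_le_mul_of_nonneg_left (hq j i).le (abs_nonneg _)
  have hC : ∀ᶠ j : ℕ in Filter.atTop, ∑ i, |x i| < j :=
    tendsto_natCast_atTop_atTop.eventually_gt_atTop _
  have hgap : ∀ᶠ j : ℕ in Filter.atTop, 0 < v ⬝ᵥ x → 2 / (v ⬝ᵥ x) < j := by
    filter_upwards [tendsto_natCast_atTop_atTop.eventually_gt_atTop (2 / (v ⬝ᵥ x))] with j hj _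
    exact hj
  filter_upwards [hC, hgap] with j hj hgj
  have hj1 : (0 : ℝ) < j + 1 := by positivity
  have hlt : |v ⬝ᵥ x - (fun i => (q j i : ℝ)) ⬝ᵥ x| < 1 / ((j : ℝ) + 1) := by
    refine (hdiff j).trans_lt ?_
    rw [div_lt_div_iff₀ (by positivity) hj1]
    nlinarith
  rw [abs_lt] at hlt
  unfold halfspaceInd
  rw [Matrix.cons_dotProduct_cons]
  push_cast
  refine if_congr ?_ rfl rfl
  constructor
  · intro h
    by_contra! hpos
    have h2 := hgj hpos
    rw [div_lt_iff₀ hpos] at h2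
    have h3 : 2 / ((j : ℝ) + 1) < v ⬝ᵥ x := by
      rw [div_lt_iff₀ hj1]
      linarith
    have h4 : 2 / ((j : ℝ) + 1) = 1 / (j + 1) + 1 / (j + 1) := by ring
    linarith [hlt.2]
  · intro h
    linarith [hlt.1]

theorem measurable_vecCons {Z : Type*} [MeasurableSpace Z] {m : ℕ} {f : Z → ℝ}
    {ψ : Z → Fin m → ℝ} (hf : Measurable f) (hψ : Measurable ψ) :
    Measurable fun z => (Matrix.vecCons (f z) (ψ z) : Fin (m + 1) → ℝ) := by
  refine measurable_pi_iff.2 fun i => Fin.cases ?_ (fun i => ?_) i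
  · simpa using hf
  · simp only [Matrix.cons_val_succ]
    exact (measurable_pi_apply i).comp hψ

/-- Indicators of the rational halfspaces converge pointwise, hence in the integral by dominated
convergence and at the finitely many sample points. A strict inequality therefore already holds for
some rational halfspace. -/
theorem exists_rat_deviation {Z α : Type*} [MeasurableSpace Z] [Fintype α] (D : Measure Z)
    [IsProbabilityMeasure D] {m : ℕ} {ψ : Z → Fin m → ℝ} (hψ : Measurable ψ) (v : Fin m → ℝ)
    (S : α → Z) {c : ℝ}
    (hc : c < Fintype.card α * ∫ z, halfspaceInd v (ψ z) ∂D - ∑ n, halfspaceInd v (ψ (S n))) :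
    ∃ i : (Fin m → ℚ) × ℚ, c <
      Fintype.card α * ∫ z, halfspaceInd (Matrix.vecCons (i.2 : ℝ) fun a => (i.1 a : ℝ))
        (Matrix.vecCons (-1) (ψ z)) ∂D
      - ∑ n, halfspaceInd (Matrix.vecCons (i.2 : ℝ) fun a => (i.1 a : ℝ))
        (Matrix.vecCons (-1) (ψ (S n))) := by
  obtain ⟨q, hq⟩ := exists_rat_halfspace_tendsto v
  have hcons : Measurable fun z => (Matrix.vecCons (-1) (ψ z) : Fin (m + 1) → ℝ) :=
    measurable_vecCons measurable_const hψ
  have hlim := ((tendsto_integral_of_dominated_convergence (μ := D) (fun _ => (1 : ℝ))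
    (F := fun (j : ℕ) z => halfspaceInd (Matrix.vecCons ((1 / (j + 1) : ℚ) : ℝ)
      fun i => (q j i : ℝ)) (Matrix.vecCons (-1) (ψ z)))
    (f := fun z => halfspaceInd v (ψ z))
    (fun j => ((measurable_halfspaceInd _).comp hcons).aestronglyMeasurable)
    (integrable_const _)
    (fun j => ae_of_all _ fun z => by
      rw [Real.norm_eq_abs, abs_le]
      have := halfspaceInd_mem_Icc (Matrix.vecCons ((1 / (j + 1) : ℚ) : ℝ)
        fun i => (q j i : ℝ)) (Matrix.vecCons (-1) (ψ z))
      exact ⟨by linarith [this.1], this.2⟩)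
    (ae_of_all _ fun z => (Filter.tendsto_congr' (hq (ψ z))).2 tendsto_const_nhds)).const_mul
      (Fintype.card α : ℝ)).sub
    (tendsto_finsetSum Finset.univ fun n _ =>
      (Filter.tendsto_congr' (hq (ψ (S n)))).2 tendsto_const_nhds)
  obtain ⟨j, hj⟩ := (hlim.eventually_const_lt hc).exists
  exact ⟨(q j, 1 / (j + 1)), hj⟩

/-- The uniform one-sided deviation bound for homogeneous halfspaces in a random feature space
that is independent of the sample. -/
theorem measure_prod_halfspace_deviation_le {Ω Z α : Type*} [MeasurableSpace Ω]
    [MeasurableSpace Z] [Fintype α] [Nonempty α] (μ : Measure Ω) [IsProbabilityMeasure μ]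
    (D : Measure Z) [IsProbabilityMeasure D] {m : ℕ} {ψ : Ω → Z → Fin m → ℝ}
    (hψ : Measurable (Function.uncurry ψ)) {L : ℝ} (hL : 0 ≤ L) :
    (μ.prod (Measure.pi fun _ : α => D))
        {q | ∃ v, 48 * √(Fintype.card α * (3 * (m + 1) + L)) <
          Fintype.card α * ∫ z, halfspaceInd v (ψ q.1 z) ∂D
            - ∑ n, halfspaceInd v (ψ q.1 (q.2 n))}
      ≤ ENNReal.ofReal (2 * Real.exp (-L)) := by
  let vec : (Fin m → ℚ) × ℚ → Fin (m + 1) → ℝ := fun i =>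
    Matrix.vecCons (i.2 : ℝ) fun a => (i.1 a : ℝ)
  let φ : Ω → Z → Fin (m + 1) → ℝ := fun R z => Matrix.vecCons (-1) (ψ R z)
  have hφ : Measurable (Function.uncurry φ) :=
    measurable_vecCons measurable_const hψ
  have hφR : ∀ R, Measurable (φ R) := fun R => hφ.comp measurable_prodMk_left
  set bad : Set (Ω × (α → Z)) := {q | ∃ i, 48 * √(Fintype.card α * (3 * ((m + 1 : ℕ) : ℝ) + L)) <
    Fintype.card α * ∫ z, halfspaceInd (vec i) (φ q.1 z) ∂D
      - ∑ n, halfspaceInd (vec i) (φ q.1 (q.2 n))} with hbad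
  have hmeas : MeasurableSet bad := by
    rw [hbad, Set.ofPred_exists]
    refine MeasurableSet.iUnion fun i => measurableSet_lt measurable_const ?_
    have h1 : Measurable fun q : Ω × Z => halfspaceInd (vec i) (φ q.1 q.2) :=
      (measurable_halfspaceInd _).comp hφ
    have h2 : Measurable fun R => ∫ z, halfspaceInd (vec i) (φ R z) ∂D :=
      (h1.stronglyMeasurable.integral_prod_right (ν := D)).measurable
    refine ((h2.comp measurable_fst).const_mul _).sub (Finset.measurable_fun_sum _ fun n _ => ?_)
    exact h1.comp (measurable_fst.prodMk ((measurable_pi_apply n).comp measurable_snd))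
  -- The event over all real `v` need not be measurable; it is enclosed in the countable, measurable
  -- event, to which Fubini applies.
  refine (measure_mono (t := bad) ?_).trans ?_
  · rintro ⟨R, S⟩ ⟨v, hv⟩
    obtain ⟨i, hi⟩ := exists_rat_deviation D (hψ.comp measurable_prodMk_left) v S hv
    refine ⟨i, ?_⟩
    push_cast
    exact hi
  · rw [Measure.prod_apply hmeas]
    calc _ ≤ ∫⁻ _, ENNReal.ofReal (2 * Real.exp (-L)) ∂μ := lintegral_mono fun R =>
          measure_pi_halfspace_deviation_le D m.succ_pos vec (hφR R) hL
      _ = _ := by simp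

/-! ### Concentration of one bounded variable -/

/-- The better of Markov's and Hoeffding's inequalities for a random variable in `[0, 1]`. -/
theorem measure_markov_hoeffding_le {Ω : Type*} [MeasurableSpace Ω] (μ : Measure Ω)
    [IsProbabilityMeasure μ] {X : Ω → ℝ} (hX : Measurable X)
    (h01 : ∀ ω, X ω ∈ Set.Icc (0 : ℝ) 1) {δ : ℝ} (hδ : 0 < δ) (hδ1 : δ < 1) :
    μ {ω | ∫ ω, X ω ∂μ + min ((1 - δ) / δ * ∫ ω, X ω ∂μ) (√(1 / 2 * Real.log (1 / δ))) < X ω}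
      ≤ ENNReal.ofReal δ := by
  have hint : Integrable X μ := Integrable.of_mem_Icc 0 1 hX.aemeasurable (ae_of_all _ h01)
  have hlog : 0 ≤ Real.log (1 / δ) := Real.log_nonneg (by rw [le_div_iff₀ hδ]; linarith)
  set A := ∫ ω, X ω ∂μ with hA
  have hA0 : 0 ≤ A := integral_nonneg fun ω => (h01 ω).1
  rcases min_cases ((1 - δ) / δ * A) (√(1 / 2 * Real.log (1 / δ))) with ⟨h, -⟩ | ⟨h, -⟩ <;> rw [h]
  · have hAδ : A + (1 - δ) / δ * A = A / δ := by field_simp; ring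
    rw [hAδ]
    -- Markov's inequality is divided by the mean, so mean zero is separate: there `X` vanishes
    -- almost everywhere.
    rcases hA0.eq_or_lt with h0 | hpos
    · have hae := (integral_eq_zero_iff_of_nonneg (fun ω => (h01 ω).1) hint).1 h0.symm
      rw [← h0, zero_div]
      refine le_of_eq_of_le (measure_mono_null (fun ω hω => ?_) hae) zero_le
      exact (show 0 < X ω from hω).ne'
    · rw [← ofReal_measureReal]
      refine ENNReal.ofReal_le_ofReal ?_
      have h1 := mul_meas_ge_le_integral_of_nonneg (ae_of_all μ fun ω => (h01 ω).1) hint (A / δ)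
      rw [← hA] at h1
      have h2 : μ.real {ω | A / δ < X ω} ≤ μ.real {ω | A / δ ≤ X ω} :=
        measureReal_mono fun ω (hω : A / δ < X ω) => hω.le
      rw [div_mul_eq_mul_div, div_le_iff₀ hδ] at h1
      have h3 := le_of_mul_le_mul_left h1 hpos
      exact h2.trans h3
  · rw [← ofReal_measureReal]
    refine ENNReal.ofReal_le_ofReal ?_
    -- Hoeffding's lemma for a single variable, with variance proxy `1 / 4`: the tail `exp (-2 t²)`
    -- equals `δ` at `t² = log (1 / δ) / 2`.
    have h1 := (hasSubgaussianMGF_of_mem_Icc hX.aemeasurable (ae_of_all μ h01)).measure_ge_le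
      (Real.sqrt_nonneg (1 / 2 * Real.log (1 / δ)))
    rw [Real.sq_sqrt (by positivity)] at h1
    have h2 : Real.exp (-(1 / 2 * Real.log (1 / δ)) / (2 * ((‖(1 : ℝ) - 0‖₊ / 2) ^ 2 : NNReal)))
        = δ := by
      have : -(1 / 2 * Real.log (1 / δ)) / (2 * ((‖(1 : ℝ) - 0‖₊ / 2) ^ 2 : NNReal))
          = Real.log δ := by
        simp
        ring
      rw [this, Real.exp_log hδ]
    rw [h2] at h1
    refine le_trans (measureReal_mono fun ω hω => ?_) h1
    simp only [Set.mem_ofPred_eq] at hω ⊢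
    linarith

/-! ### Compressive classifiers as halfspaces, and flipped points -/

theorem isProbabilityMeasure_matrixLaw (ρ : Measure ℝ) [IsProbabilityMeasure ρ] (k d : ℕ) :
    IsProbabilityMeasure (matrixLaw ρ k d) := by
  unfold matrixLaw
  infer_instance

theorem project_smul {k d : ℕ} (R : ProjMatrix k d) (c : ℝ) (x : Input d) :
    project R (c • x) = c • project R x := by
  simp [project, Matrix.mulVec_smul]

theorem measurable_project {k d : ℕ} :
    Measurable fun q : ProjMatrix k d × Input d => project q.1 q.2 := by
  refine measurable_pi_iff.2 fun i => ?_
  simp only [project, Matrix.mulVec, dotProduct, Matrix.of_apply]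
  refine Finset.measurable_fun_sum _ fun j _ => ?_
  have h1 : Measurable fun q : ProjMatrix k d × Input d => q.1 i j :=
    (measurable_pi_apply j).comp ((measurable_pi_apply i).comp measurable_fst)
  have h2 : Measurable fun q : ProjMatrix k d × Input d => q.2.ofLp j := by fun_prop
  exact h1.mul h2

theorem measurable_signed {d : ℕ} : Measurable (signed (d := d)) := by
  unfold signed
  fun_prop

theorem label_cases (y : Label) : (y : ℝ) = -1 ∨ (y : ℝ) = 1 :=
  y.2

/-- Since `sign 0 = 0` is never a label, boundary points are errors, in agreement with the closed
condition `s y ≤ 0`. -/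
theorem zeroOneLoss_sign (s : ℝ) (y : Label) :
    zeroOneLoss (Real.sign s) y = if s * y ≤ 0 then 1 else 0 := by
  unfold zeroOneLoss
  refine if_congr ?_ rfl rfl
  rcases label_cases y with h | h <;> rw [h] <;> rcases lt_trichotomy s 0 with hs | hs | hs
  · simp [Real.sign_of_neg hs, hs]
  · simp [hs]
  · simp [Real.sign_of_pos hs, hs.le]
    norm_num
  · simp [Real.sign_of_neg hs, hs.le]
    norm_num
  · simp [hs]
  · simp [Real.sign_of_pos hs, hs]

/-- The feature vector `y (1, R x)` of an observation `(x, y)`. -/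
def signedFeature {k d : ℕ} (R : ProjMatrix k d) (z : Obs d) : Fin (k + 1) → ℝ :=
  (z.2 : ℝ) • Matrix.vecCons 1 (project R z.1)

theorem measurable_signedFeature {k d : ℕ} :
    Measurable (Function.uncurry (signedFeature (k := k) (d := d))) := by
  have h1 : Measurable fun q : ProjMatrix k d × Obs d => project q.1 q.2.1 :=
    measurable_project.comp (measurable_fst.prodMk (measurable_fst.comp measurable_snd))
  have h2 : Measurable fun q : ProjMatrix k d × Obs d => (q.2.2 : ℝ) := by fun_prop
  exact h2.smul (measurable_vecCons measurable_const h1)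

theorem vecCons_dotProduct_signedFeature {k d : ℕ} (R : ProjMatrix k d) (w : Fin k → ℝ) (b : ℝ)
    (z : Obs d) : Matrix.vecCons b w ⬝ᵥ signedFeature R z = score R w b z.1 * z.2 := by
  simp only [signedFeature, dotProduct_smul, Matrix.cons_dotProduct_cons, smul_eq_mul, score]
  ring

theorem empiricalError_eq {k d N : ℕ} (R : ProjMatrix k d) (S : Fin N → Obs d) (w : Fin k → ℝ)
    (b : ℝ) : empiricalError R S w b
      = (1 / (N : ℝ)) * ∑ n, halfspaceInd (Matrix.vecCons b w) (signedFeature R (S n)) := by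
  simp only [empiricalError, zeroOneLoss_sign, halfspaceInd, vecCons_dotProduct_signedFeature]

theorem generalizationError_eq {k d : ℕ} (D : Measure (Obs d)) (R : ProjMatrix k d)
    (w : Fin k → ℝ) (b : ℝ) : generalizationError D R w b
      = ∫ z, halfspaceInd (Matrix.vecCons b w) (signedFeature R z) ∂D := by
  have hm : Measurable fun z => halfspaceInd (Matrix.vecCons b w) (signedFeature R z) :=
    (measurable_halfspaceInd _).comp (measurable_signedFeature.comp measurable_prodMk_left)
  have hind : ∀ z : Obs d, halfspaceInd (Matrix.vecCons b w) (signedFeature R z)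
      = if score R w b z.1 * z.2 ≤ 0 then 1 else 0 := fun z => by
    rw [halfspaceInd, vecCons_dotProduct_signedFeature]
  have hs : MeasurableSet {z : Obs d | score R w b z.1 * (z.2 : ℝ) ≤ 0} := by
    have h := hm (measurableSet_singleton 1)
    convert h using 1
    ext z
    simp [hind]
  rw [generalizationError, ← integral_indicator_one hs]
  refine integral_congr_ae (ae_of_all _ fun z => ?_)
  simp [hind, Set.indicator_apply]

/-- The fraction of sample points with margin above `γ` that the projection flips. -/
noncomputable def flippedFraction {k d N : ℕ} (γ : ℝ) (h : Input d) (R : ProjMatrix k d)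
    (S : Fin N → Obs d) : ℝ :=
  (1 / (N : ℝ)) * ∑ n, (if project R h ⬝ᵥ project R (signed (S n)) ≤ 0 then 1 else 0)
    * (if γ < cosAngle h (signed (S n)) then 1 else 0)

/-- The projected classifier `R h` errs on points of small margin or on flipped points. -/
theorem empiricalError_project_le {k d N : ℕ} (γ : ℝ) (h : Input d) (R : ProjMatrix k d)
    (S : Fin N → Obs d) :
    empiricalError R S (project R h) 0 ≤ marginError γ h S + flippedFraction γ h R S := by
  have hscore : ∀ z : Obs d, score R (project R h) 0 z.1 * z.2
      = project R h ⬝ᵥ project R (signed z) := fun z => by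
    rw [signed, project_smul, dotProduct_smul, score, smul_eq_mul]
    ring
  unfold empiricalError marginError flippedFraction
  rw [← mul_add, ← Finset.sum_add_distrib]
  refine mul_le_mul_of_nonneg_left (Finset.sum_le_sum fun n _ => ?_) (by positivity)
  rw [zeroOneLoss_sign, hscore]
  rcases le_or_gt (cosAngle h (signed (S n))) γ with hγ | hγ
  · rw [if_pos hγ, if_neg hγ.not_gt]
    split_ifs <;> norm_num
  · rw [if_neg hγ.not_ge, if_pos hγ]
    simp

theorem flippedFraction_mem_Icc {k d N : ℕ} (γ : ℝ) (h : Input d) (R : ProjMatrix k d)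
    (S : Fin N → Obs d) : flippedFraction γ h R S ∈ Set.Icc (0 : ℝ) 1 := by
  unfold flippedFraction
  constructor
  · refine mul_nonneg (by positivity) (Finset.sum_nonneg fun n _ => ?_)
    split_ifs <;> norm_num
  · rw [one_div, inv_mul_eq_div]
    refine div_le_one_of_le₀ ?_ (by positivity)
    calc _ ≤ ∑ _n : Fin N, (1 : ℝ) := Finset.sum_le_sum fun n _ => by split_ifs <;> norm_num
      _ = N := by simp

theorem measurable_cosAngle {d : ℕ} (h : Input d) : Measurable (cosAngle h) := by
  unfold cosAngle InnerProductGeometry.angle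
  fun_prop

theorem measurableSet_flip {k d : ℕ} (h : Input d) :
    MeasurableSet {q : ProjMatrix k d × Input d | project q.1 h ⬝ᵥ project q.1 q.2 ≤ 0} := by
  have h1 : Measurable fun q : ProjMatrix k d × Input d => project q.1 h :=
    measurable_project.comp (measurable_fst.prodMk measurable_const)
  have h2 := measurable_project (k := k) (d := d)
  refine measurableSet_le ?_ measurable_const
  unfold dotProduct
  exact Finset.measurable_fun_sum _ fun i _ =>
    ((measurable_pi_apply i).comp h1).mul ((measurable_pi_apply i).comp h2)

theorem measurable_flip_mul_margin {k d : ℕ} (γ : ℝ) (h : Input d) :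
    Measurable fun q : ProjMatrix k d × Input d =>
      (if project q.1 h ⬝ᵥ project q.1 q.2 ≤ 0 then (1 : ℝ) else 0)
        * (if γ < cosAngle h q.2 then (1 : ℝ) else 0) := by
  have h1 : Measurable fun q : ProjMatrix k d × Input d =>
      if project q.1 h ⬝ᵥ project q.1 q.2 ≤ 0 then (1 : ℝ) else 0 :=
    Measurable.ite (measurableSet_flip h) measurable_const measurable_const
  have h2 : Measurable fun u : Input d => if γ < cosAngle h u then (1 : ℝ) else 0 :=
    Measurable.ite (measurableSet_lt measurable_const (measurable_cosAngle h)) measurable_const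
      measurable_const
  exact h1.mul (h2.comp measurable_snd)

theorem measurable_flippedFraction {k d N : ℕ} (γ : ℝ) (h : Input d) :
    Measurable fun q : ProjMatrix k d × (Fin N → Obs d) => flippedFraction γ h q.1 q.2 := by
  have hterm : ∀ n : Fin N, Measurable fun q : ProjMatrix k d × (Fin N → Obs d) =>
      (q.1, signed (q.2 n)) := fun n => by
    have hn : Measurable fun q : ProjMatrix k d × (Fin N → Obs d) => q.2 n := by fun_prop
    exact measurable_fst.prodMk (measurable_signed.comp hn)
  have hsum := (Finset.measurable_fun_sum (Finset.univ : Finset (Fin N)) fun n _ =>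
    (measurable_flip_mul_margin (k := k) γ h).comp (hterm n)).const_mul (1 / (N : ℝ))
  exact hsum

/-- The margin indicator does not involve `R`, so it factors out of the expectation of each flip
indicator. -/
theorem integral_flippedFraction {k d N : ℕ} (ρ : Measure ℝ) [IsProbabilityMeasure ρ] (γ : ℝ)
    (h : Input d) (S : Fin N → Obs d) :
    ∫ R, flippedFraction γ h R S ∂(matrixLaw ρ k d) = avgFlipProbMargin ρ k γ h S := by
  have := isProbabilityMeasure_matrixLaw ρ k d
  have hm : ∀ u : Input d,
      MeasurableSet {R : ProjMatrix k d | project R h ⬝ᵥ project R u ≤ 0} := fun u =>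
    (measurableSet_flip h).preimage measurable_prodMk_right
  have hind : ∀ u : Input d, (fun R : ProjMatrix k d =>
      if project R h ⬝ᵥ project R u ≤ 0 then (1 : ℝ) else 0)
        = {R | project R h ⬝ᵥ project R u ≤ 0}.indicator 1 := fun u => by
    ext R
    simp [Set.indicator_apply]
  have hint : ∀ u : Input d, Integrable (fun R : ProjMatrix k d =>
      if project R h ⬝ᵥ project R u ≤ 0 then (1 : ℝ) else 0) (matrixLaw ρ k d) := fun u => by
    rw [hind]
    exact (integrable_const (1 : ℝ)).indicator (hm u)
  unfold flippedFraction avgFlipProbMargin flipProbMargin flipProb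
  rw [integral_const_mul, integral_finsetSum _ fun n _ => (hint _).mul_const _]
  congr 1
  refine Finset.sum_congr rfl fun n _ => ?_
  rw [integral_mul_const, hind, integral_indicator_one (hm _)]

theorem measurable_avgFlipProbMargin {d N : ℕ} (ρ : Measure ℝ) [IsProbabilityMeasure ρ] (k : ℕ)
    (γ : ℝ) (h : Input d) :
    Measurable fun S : Fin N → Obs d => avgFlipProbMargin ρ k γ h S := by
  have := isProbabilityMeasure_matrixLaw ρ k d
  simp only [← integral_flippedFraction]
  exact ((measurable_flippedFraction γ h).stronglyMeasurable.integral_prod_left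
    (μ := matrixLaw ρ k d)).measurable

/-- Conditionally on the sample only `R` is random. All points share this `R`, so their flips form
one bounded variable with no gain from averaging; the bound is then integrated over samples. -/
theorem measure_flippedFraction_le {d : ℕ} (k N : ℕ) (D : Measure (Obs d))
    [IsProbabilityMeasure D] (ρ : Measure ℝ) [IsProbabilityMeasure ρ] (γ : ℝ) (h : Input d)
    {δ : ℝ} (hδ : 0 < δ) (hδ1 : δ < 1) :
    ((matrixLaw ρ k d).prod (sampleLaw D N))
      {q | avgFlipProbMargin ρ k γ h q.2 + min ((1 - δ) / δ * avgFlipProbMargin ρ k γ h q.2)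
        (√(1 / 2 * Real.log (1 / δ))) < flippedFraction γ h q.1 q.2} ≤ ENNReal.ofReal δ := by
  have := isProbabilityMeasure_matrixLaw ρ k d
  have : IsProbabilityMeasure (sampleLaw D N) := by unfold sampleLaw; infer_instance
  have hA : Measurable fun q : ProjMatrix k d × (Fin N → Obs d) =>
      avgFlipProbMargin ρ k γ h q.2 :=
    (measurable_avgFlipProbMargin ρ k γ h).comp measurable_snd
  have hmeas : MeasurableSet {q : ProjMatrix k d × (Fin N → Obs d) |
      avgFlipProbMargin ρ k γ h q.2 + min ((1 - δ) / δ * avgFlipProbMargin ρ k γ h q.2)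
        (√(1 / 2 * Real.log (1 / δ))) < flippedFraction γ h q.1 q.2} :=
    measurableSet_lt (hA.add ((hA.const_mul _).min measurable_const))
      (measurable_flippedFraction γ h)
  rw [Measure.prod_apply_symm hmeas]
  calc _ ≤ ∫⁻ _, ENNReal.ofReal δ ∂(sampleLaw D N) := lintegral_mono fun S => by
        have hX := measure_markov_hoeffding_le (matrixLaw ρ k d)
          ((measurable_flippedFraction γ h).comp (measurable_prodMk_right (y := S)))
          (fun R => flippedFraction_mem_Icc γ h R S) hδ hδ1
        simp only [Function.comp_def, integral_flippedFraction] at hX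
        exact hX
    _ = _ := by simp

/-! ### The margin bound -/

/-- Outside a set of pairs (projection matrix, training set) of probability at most `2 δ`, every
compressive empirical risk minimizer satisfies the margin bound; `c` is an absolute constant. -/
theorem corollary1 :
    ∃ c : ℝ, 0 < c ∧
      ∀ (γ : ℝ), 0 < γ →
      ∀ (d k N : ℕ), k ≤ d → 0 < N →
      ∀ (D : Measure (Obs d)), IsProbabilityMeasure D →
      ∀ (h : Input d),
      ∀ (ρ : Measure ℝ), IsProbabilityMeasure ρ → IsSubgaussianLaw ρ →
      ∀ (δ : ℝ), 0 < δ → δ < 1 →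
        ((matrixLaw ρ k d).prod (sampleLaw D N))
          {RS | ¬ ∀ (w : Fin k → ℝ) (b : ℝ), IsCompressiveERM RS.1 RS.2 w b →
            generalizationError D RS.1 w b ≤
              marginError γ h RS.2
              + c * √(((k : ℝ) + 1 + Real.log (1 / δ)) / (N : ℝ))
              + avgFlipProbMargin ρ k γ h RS.2
              + min ((1 - δ) / δ * avgFlipProbMargin ρ k γ h RS.2)
                  (√(1 / 2 * Real.log (1 / δ)))}
          ≤ ENNReal.ofReal (2 * δ) := by
  -- Here `144 = 48 · 3`, the 3 coming from `3 (k + 2) + log 2 + log (1 / δ) ≤ 9 (k + 1 + log (1 /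
  -- δ))`. The dimension is `k + 2`: `k` weights, the bias, and the intercept of the rational
  -- approximation.
  refine ⟨144, by norm_num, ?_⟩
  intro γ _ d k N _ hN D hD h ρ hρ _ δ hδ hδ1
  have := isProbabilityMeasure_matrixLaw ρ k d
  have : Nonempty (Fin N) := ⟨⟨0, hN⟩⟩
  have hN0 : (0 : ℝ) < N := by exact_mod_cast hN
  have hlog : 0 ≤ Real.log (1 / δ) := Real.log_nonneg (by rw [le_div_iff₀ hδ]; linarith)
  -- The 2 cancels the factor lost in symmetrization, so each of the two bad events has probability
  -- at most `δ`.
  set L := Real.log (2 / δ) with hL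
  have hL2 : L = Real.log 2 + Real.log (1 / δ) := by
    rw [hL, ← Real.log_mul (by norm_num) (by positivity), mul_one_div]
  have hlog2 : 0 ≤ Real.log 2 := Real.log_nonneg (by norm_num)
  have hexp : 2 * Real.exp (-L) = δ := by
    rw [hL, ← Real.log_inv, Real.exp_log (by positivity), inv_div]
    ring
  have hdev := measure_prod_halfspace_deviation_le (α := Fin N) (matrixLaw ρ k d) D
    (measurable_signedFeature (k := k) (d := d)) (L := L) (by rw [hL2]; positivity)
  have hflip := measure_flippedFraction_le k N D ρ γ h hδ hδ1
  rw [hexp] at hdev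
  refine (measure_mono fun q hq => ?_).trans ((measure_union_le _ _).trans
    ((add_le_add hdev hflip).trans_eq ?_))
  · by_contra hno
    simp only [Set.mem_union, Set.mem_ofPred_eq, not_or, not_exists, not_lt,
      Fintype.card_fin] at hno
    obtain ⟨h1, h2⟩ := hno
    refine hq fun w b herm => ?_
    -- The minimizer depends on the sample; the bound may be used at it because it holds for all
    -- halfspaces simultaneously.
    have hgen := h1 (Matrix.vecCons b w)
    rw [← generalizationError_eq] at hgen
    have hemp := (herm (project q.1 h) 0).trans (empiricalError_project_le γ h q.1 q.2)
    rw [empiricalError_eq, one_div, inv_mul_eq_div, div_le_iff₀ hN0] at hemp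
    have hrate : 48 * √(N * (3 * (((k + 1 : ℕ) : ℝ) + 1) + L))
        ≤ 144 * √(((k : ℝ) + 1 + Real.log (1 / δ)) / N) * N := by
      have hk : (0 : ℝ) ≤ k := by positivity
      have hl2 := Real.log_two_lt_d9
      have h9 : N * (3 * (((k + 1 : ℕ) : ℝ) + 1) + L)
          ≤ (3 * N) ^ 2 * (((k : ℝ) + 1 + Real.log (1 / δ)) / N) := by
        have : (3 * N) ^ 2 * (((k : ℝ) + 1 + Real.log (1 / δ)) / N)
            = N * (9 * ((k : ℝ) + 1 + Real.log (1 / δ))) := by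
          field_simp
          ring
        rw [this, hL2]
        refine mul_le_mul_of_nonneg_left ?_ hN0.le
        push_cast
        linarith
      have h10 := Real.sqrt_le_sqrt h9
      rw [Real.sqrt_mul (sq_nonneg (3 * (N : ℝ))), Real.sqrt_sq (by positivity)] at h10
      linarith
    have hmul : N * generalizationError D q.1 w b ≤ N * (marginError γ h q.2
        + 144 * √(((k : ℝ) + 1 + Real.log (1 / δ)) / N) + flippedFraction γ h q.1 q.2) := by
      linarith
    have := le_of_mul_le_mul_left hmul hN0
    linarith
  · rw [← ENNReal.ofReal_add hδ.le hδ.le, two_mul]
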